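/- **Setting.** Let $\mathcal S,\mathcal A$ be measurable spaces, $\nu$ a $\sigma$-finite reference measure on $\mathcal S$ (counting measure if $\mathcal S$ is countable), $d_0$ a probability distribution on $\mathcal S$ and $\gamma\in[0,1)$. A model $M=(P_M,R_M)$ consists of transition probabilities with a jointly measurable density $P_M(s'\mid s,a)$ with respect to $\nu$ and a measurable reward function $R_M:\mathcal S\times\mathcal A\to[0,1]$. A policy is a Markov kernel $\pi(\cdot\mid s)$ from $\mathcal S$ to $\mathcal A$. For a policy $\pi$ run on $M$ from $s_0\sim d_0$ put $$J_M(\pi)=\mathbb E_{\pi,M}\Big[\sum_{t\ge 0}\gamma^t R_M(s_t,a_t)\Big],\qquad d_M^\pi=(1-\gamma)\sum_{t\ge 0}\gamma^t\,\Pr_{\pi,M}\big((s_t,a_t)\in\cdot\big),$$ and let $V_M^\pi(s)$ be the same expected return when the chain starts in $s_0=s$. Let $\mathcal M$ be a finite class of models that contains the true model $M^\star$ (realizability), with $P^\star=P_{M^\star}$, $R^\star=R_{M^\star}$, $J=J_{M^\star}$ and $d^\pi=d^\pi_{M^\star}$. Let $\Pi$ be a set of policies, $\pi_{\mathrm{ref}}$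 any policy (not necessarily in $\Pi$), and $V_{\max}\ge 1$ such that $V_M^\pi(s)\in[0,V_{\max}]$ for all $M\in\mathcal M$, $\pi\in\Pi\cup\{\pi_{\mathrm{ref}}\}$ and $s\in\mathcal S$. The data $\mathcal D$ are $n\ge 1$ independent tuples $(s,a,r,s')$, where $(s,a)\sim\mu:=d^{\pi_b}$ for a behavior policy $\pi_b$ and, given $(s,a)$, $s'\sim P^\star(\cdot\mid s,a)$ and $r\in[0,1]$ has mean $R^\star(s,a)$ (for instance $r=R^\star(s,a)$). With $$\mathcal E_{\mathcal D}(M)=\sum_{(s,a,r,s')\in\mathcal D}\Big(-\log P_M(s'\mid s,a)+\frac{(R_M(s,a)-r)^2}{V_{\max}^2}\Big)\in(-\infty,\infty],$$ $$\mathcal M_\alpha=\Big\{M\in\mathcal M:\ \mathcal E_{\mathcal D}(M)-\min_{M'\in\mathcal M}\mathcal E_{\mathcal D}(M')\le\alpha\Big\},$$ an ARMOR policy is any $$\hat\pi\in\operatorname*{argmax}_{\pi\in\Pi}\ \min_{M\in\mathcal M_\alpha}\big(J_M(\pi)-J_M(\pi_{\mathrm{ref}})\big).$$ The generalized single-policy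 concentrability coefficient of a policy $\pi$ is $$\mathfrak C_{\mathcal M}(\pi)=\sup_{M\in\mathcal M}\frac{\mathbb E_{d^\pi}[\mathcal E^\star(M)]}{\mathbb E_{\mu}[\mathcal E^\star(M)]}\in[0,\infty],\qquad \mathcal E^\star(M)(s,a)=\mathrm{TV}\big(P_M(\cdot\mid s,a),P^\star(\cdot\mid s,a)\big)^2+\frac{(R_M(s,a)-R^\star(s,a))^2}{V_{\max}^2},$$ where $0/0=0$, $x/0=\infty$ for $x>0$, and $\mathrm{TV}$ is half the $L^1(\nu)$ distance of the densities. **Theorem (absolute performance).** There are absolute constants $c,C>0$ such that, in every such setting and for every $\delta\in(0,1]$, if $\alpha=c\log(|\mathcal M|/\delta)$, then for every reference policy $\pi_{\mathrm{ref}}$ and every comparator $\pi\in\Pi$, with probability at least $1-\delta$ over $\mathcal D$, every ARMOR policy $\hat\pi$ satisfies $$J(\pi)-J(\hat\pi)\ \le\ C\Big(\sqrt{\mathfrak C_{\mathcal M}(\pi)}+\sqrt{\mathfrak C_{\mathcal M}(\pi_{\mathrm{ref}})}\Big)\,\frac{V_{\max}}{1-\gamma}\,\sqrt{\frac{\log(|\mathcal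 M|/\delta)}{n}}$$ (with $\infty\cdot 0=0$ on the right-hand side; "with probability at least $1-\delta$" means that the set of data sets on which the assertion fails has outer measure at most $\delta$). -/

import Mathlib

open MeasureTheory ProbabilityTheory
open scoped ENNReal NNReal

noncomputable section

namespace OfflineRL

/-- An MDP model `M = (P_M, R_M)` on the state space `S` and the action space `A`.
The transition dynamics are given by the conditional densities `P_M(s' ∣ s, a) = M.p (s, a) s'`
with respect to a fixed reference measure `ν` on the states; for a countable state space with
counting measure, `M.p` is the transition probability mass function.
The rewards take values in `[0, 1]`. -/
structure Model (S A : Type*) [MeasurableSpace S] [MeasurableSpace A] (ν : Measure S) where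
  /-- transition density `P_M(s' ∣ s, a)` -/
  p : S × A → S → ℝ≥0
  measurable_p : Measurable (Function.uncurry p)
  lintegral_p : ∀ x, ∫⁻ s', (p x s' : ℝ≥0∞) ∂ν = 1
  /-- reward function `R_M(s, a)` -/
  R : S × A → ℝ
  measurable_R : Measurable R
  R_mem : ∀ x, R x ∈ Set.Icc (0 : ℝ) 1

/-- A (Markovian) policy: each state is mapped to a distribution on the actions. -/
structure Policy (S A : Type*) [MeasurableSpace S] [MeasurableSpace A] where
  /-- the distribution of the action, given the state -/
  act : Kernel S A
  markov : IsMarkovKernel act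

attribute [instance] Policy.markov

section Dynamics

variable {S A : Type*} [MeasurableSpace S] [MeasurableSpace A] {ν : Measure S} [SigmaFinite ν]

/-- The transition dynamics `P_M : S × A → Δ(S)`. -/
def Model.P (M : Model S A ν) : Kernel (S × A) S :=
  (Kernel.const (S × A) ν).withDensity (fun x s' => (M.p x s' : ℝ≥0∞))

instance Model.instIsMarkovKernelP (M : Model S A ν) : IsMarkovKernel M.P := by
  refine ⟨fun x => ⟨?_⟩⟩
  have h : Measurable (Function.uncurry fun x s' => (M.p x s' : ℝ≥0∞)) :=
    M.measurable_p.coe_nnreal_ennreal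
  rw [Model.P, Kernel.withDensity_apply' _ h]
  simpa using M.lintegral_p x

/-- One step of the state-action chain: `(s, a) ↦ (s', a')` with `s' ∼ P_M(· ∣ s, a)` and
`a' ∼ π(· ∣ s')`, as a kernel on the history up to time `t`. -/
def Model.step (M : Model S A ν) (π : Policy S A) (t : ℕ) :
    Kernel ((i : Finset.Iic t) → S × A) (S × A) :=
  (M.P ⊗ₖ Kernel.prodMkLeft (S × A) π.act).comap
    (fun h => h ⟨t, Finset.mem_Iic.2 le_rfl⟩) (measurable_pi_apply _)

instance Model.instIsMarkovKernelStep (M : Model S A ν) (π : Policy S A) (t : ℕ) :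
    IsMarkovKernel (M.step π t) := by
  unfold Model.step
  infer_instance

/-- The law of the trajectory `(s_t, a_t)_{t ≥ 0}` obtained by running the policy `π` on the
model `M` from the initial state distribution `d₀`. -/
def Model.traj (M : Model S A ν) (d₀ : Measure S) (π : Policy S A) : Measure (ℕ → S × A) :=
  Kernel.trajMeasure (X := fun _ => S × A) (d₀ ⊗ₘ π.act) (M.step π)

/-- The expected discounted return `J_M(π) = 𝔼_{π, M} [∑ₜ γ ^ t * R_M(s_t, a_t)]` from the initial
state distribution `d₀`. -/
def Model.J (M : Model S A ν) (γ : ℝ) (d₀ : Measure S) (π : Policy S A) : ℝ :=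
  ∫ ω, ∑' t : ℕ, γ ^ t * M.R (ω t) ∂(M.traj d₀ π)

/-- The value function `V_M^π(s)`: the expected discounted return from the state `s`. -/
def Model.V (M : Model S A ν) (γ : ℝ) (π : Policy S A) (s : S) : ℝ :=
  M.J γ (Measure.dirac s) π

/-- The discounted state-action distribution
`d_M^π = (1 - γ) * ∑ₜ γ ^ t * Pr_{π, M} ((s_t, a_t) ∈ ·)`. -/
def Model.occ (M : Model S A ν) (γ : ℝ) (d₀ : Measure S) (π : Policy S A) : Measure (S × A) :=
  Measure.sum fun t : ℕ =>
    ENNReal.ofReal ((1 - γ) * γ ^ t) • (M.traj d₀ π).map (fun ω => ω t)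

/-- The total variation distance between `P_M(· ∣ x)` and `P_{M'}(· ∣ x)`, with `x = (s, a)`. -/
def Model.tv (M M' : Model S A ν) (x : S × A) : ℝ :=
  (1 / 2) * ∫ s', |(M.p x s' : ℝ) - (M'.p x s' : ℝ)| ∂ν

/-- The pointwise squared model error of `M`, for the true model `Mstar`. -/
def Model.err (Mstar : Model S A ν) (Vmax : ℝ) (M : Model S A ν) (x : S × A) : ℝ :=
  M.tv Mstar x ^ 2 + (M.R x - Mstar.R x) ^ 2 / Vmax ^ 2

/-- The generalized single-policy concentrability coefficient of the policy `π`, for the model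
class `Ms` and the data distribution `μ` (with `0 / 0 = 0` and `x / 0 = ∞` for `x > 0`). -/
def concentrability (Mstar : Model S A ν) (γ : ℝ) (d₀ : Measure S) (Vmax : ℝ)
    (Ms : Finset (Model S A ν)) (μ : Measure (S × A)) (π : Policy S A) : ℝ≥0∞ :=
  ⨆ M ∈ Ms, (∫⁻ x, ENNReal.ofReal (Mstar.err Vmax M x) ∂(Mstar.occ γ d₀ π)) /
    (∫⁻ x, ENNReal.ofReal (Mstar.err Vmax M x) ∂μ)

/-- `Q` is a conditional law of the observed pair `(r, s')` given `(s, a)` that follows the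
model `M`: the next state has law `P_M(· ∣ s, a)`, and the observed reward lies in `[0, 1]` and has
mean `R_M(s, a)`. The noiseless reward `r = R_M(s, a)` is a special case. -/
structure Model.Follows (Q : Kernel (S × A) (ℝ × S)) (M : Model S A ν) : Prop where
  next_state : ∀ x, (Q x).map Prod.snd = M.P x
  reward_mem : ∀ x, ∀ᵐ y ∂(Q x), y.1 ∈ Set.Icc (0 : ℝ) 1
  reward_mean : ∀ x, ∫ y, y.1 ∂(Q x) = M.R x

/-- A dataset of `n` tuples `((s, a), (r, s'))`. -/
abbrev Dataset (S A : Type*) (n : ℕ) : Type _ := Fin n → (S × A) × (ℝ × S)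

/-- The law of `n` independent tuples with `(s, a) ∼ μ` and `(r, s') ∼ Q(· ∣ s, a)`. -/
def dataLaw (μ : Measure (S × A)) (Q : Kernel (S × A) (ℝ × S)) (n : ℕ) :
    Measure (Dataset S A n) :=
  Measure.pi fun _ : Fin n => μ ⊗ₘ Q

/-- The model fitting loss
`∑ (- log P_M(s' ∣ s, a) + (R_M(s, a) - r) ^ 2 / Vmax ^ 2)` over the dataset, which is `+∞` if some
observed transition has `P_M(s' ∣ s, a) = 0`. -/
def loss (Vmax : ℝ) {n : ℕ} (D : Dataset S A n) (M : Model S A ν) : EReal :=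
  ∑ i, (-ENNReal.log (M.p (D i).1 (D i).2.2 : ℝ≥0∞) +
    (((M.R (D i).1 - (D i).2.1) ^ 2 / Vmax ^ 2 : ℝ) : EReal))

/-- The version space: the models whose loss exceeds the smallest one by at most `α`. -/
def versionSpace (Ms : Finset (Model S A ν)) (Vmax α : ℝ) {n : ℕ} (D : Dataset S A n) :
    Set (Model S A ν) :=
  {M | M ∈ Ms ∧ loss Vmax D M - (⨅ M' ∈ Ms, loss Vmax D M') ≤ (α : EReal)}

/-- The worst relative performance `min_{M ∈ Mα} (J_M(π) - J_M(π_ref))` over a set `Mα` of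
models. -/
def worstGap (Mα : Set (Model S A ν)) (γ : ℝ) (d₀ : Measure S) (πref π : Policy S A) : ℝ :=
  sInf ((fun M => M.J γ d₀ π - M.J γ d₀ πref) '' Mα)

/-- `πhat` is an ARMOR policy for the data `D`: it is a maximizer over the policy class `Pol` of
the worst relative performance over the version space. -/
def IsArmorPolicy (Ms : Finset (Model S A ν)) (Pol : Set (Policy S A)) (γ : ℝ) (d₀ : Measure S)
    (Vmax α : ℝ) (πref : Policy S A) {n : ℕ} (D : Dataset S A n) (πhat : Policy S A) : Prop :=
  πhat ∈ Pol ∧ ∀ π ∈ Pol, worstGap (versionSpace Ms Vmax α D) γ d₀ πref π ≤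
    worstGap (versionSpace Ms Vmax α D) γ d₀ πref πhat

end Dynamics

end OfflineRL

end

open OfflineRL

/-! Pessimism: the learned policy is compared with the others only through the true model, so its
own coverage never matters. Suppose the version space contains $M^\star$, and let $M$ in it attain
the worst gap of the comparator $\pi$. Then $J(\hat\pi)-J(\pi_{\mathrm{ref}})$ is at least the worst
gap of $\hat\pi$, hence at least that of $\pi$, which is $J_M(\pi)-J_M(\pi_{\mathrm{ref}})$.
Therefore $J(\pi)-J(\hat\pi)\le|J_M(\pi)-J(\pi)|+|J_M(\pi_{\mathrm{ref}})-J(\pi_{\mathrm{ref}})|$.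

Each term is controlled by the simulation lemma `Model.ofReal_abs_J_sub_le`: up to the factor
$1/(1-\gamma)$ it is the mean error of $M$ under the true occupancy measure. Cauchy–Schwarz and the
concentrability coefficient move this to $\mathbb E_\mu[\mathcal E^\star(M)]$.

It remains to see that, with probability $1-\delta$, the version space contains $M^\star$ and all
its models have $\mathbb E_\mu[\mathcal E^\star]\le 16L/n$, where $L=\log(|\mathcal M|/\delta)$.
This is a likelihood-ratio argument: the mean of $\exp(-(\ell_M-\ell_{M^\star})/4)$ on one tuple is
at most $\exp(-\mathbb E_\mu[\mathcal E^\star(M)]/8)$ (`Model.lintegral_compProd_weight_le`).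
Independence, Markov's inequality and a union bound over $\mathcal M$ give
`dataLaw_versionSpace_le`. -/

namespace OfflineRL

/-! ### The state-action chain and its value functions. -/

section Chain

variable {S A : Type*} [MeasurableSpace S] [MeasurableSpace A] {ν : Measure S} [SigmaFinite ν]

/-- The transition kernel of the state-action chain of the policy `π` run on the model `M`. -/
noncomputable def Model.chain (M : Model S A ν) (π : Policy S A) : Kernel (S × A) (S × A) :=
  M.P ⊗ₖ Kernel.prodMkLeft (S × A) π.act

instance (M : Model S A ν) (π : Policy S A) : IsMarkovKernel (M.chain π) := by
  unfold Model.chain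
  infer_instance

instance (M : Model S A ν) (d₀ : Measure S) [IsProbabilityMeasure d₀] (π : Policy S A) :
    IsProbabilityMeasure (M.traj d₀ π) := by
  unfold Model.traj
  infer_instance

lemma Model.traj_map_zero (M : Model S A ν) (d₀ : Measure S) [IsProbabilityMeasure d₀]
    (π : Policy S A) : (M.traj d₀ π).map (fun ω => ω 0) = d₀ ⊗ₘ π.act := by
  have h : (fun ω : ℕ → S × A => ω 0) = (MeasurableEquiv.piUnique
      (fun _ : Finset.Iic 0 => S × A)) ∘ (Preorder.frestrictLe (π := fun _ => S × A) 0) := rfl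
  rw [h, ← Measure.map_map (by fun_prop) (by fun_prop), Model.traj, Kernel.trajMeasure,
    Measure.map_comp _ _ (by fun_prop), Kernel.traj_map_frestrictLe, Kernel.partialTraj_self,
    Measure.id_comp]
  exact (MeasurableEquiv.piUnique (fun _ : Finset.Iic 0 => S × A)).map_map_symm

lemma Model.lintegral_traj_zero (M : Model S A ν) (d₀ : Measure S) [IsProbabilityMeasure d₀]
    (π : Policy S A) {f : S × A → ℝ≥0∞} (hf : Measurable f) :
    ∫⁻ ω, f (ω 0) ∂(M.traj d₀ π) = ∫⁻ s, ∫⁻ a, f (s, a) ∂(π.act s) ∂d₀ := by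
  rw [← Measure.lintegral_compProd hf, ← M.traj_map_zero d₀ π,
    lintegral_map hf (measurable_pi_apply 0)]

/-- The Markov property: `M.step π t` depends on the history only through its last entry. -/
lemma Model.lintegral_traj_succ (M : Model S A ν) (d₀ : Measure S) [IsProbabilityMeasure d₀]
    (π : Policy S A) {f : S × A → ℝ≥0∞} (hf : Measurable f) (t : ℕ) :
    ∫⁻ ω, f (ω (t + 1)) ∂(M.traj d₀ π) =
      ∫⁻ ω, ∫⁻ y, f y ∂(M.chain π (ω t)) ∂(M.traj d₀ π) := by
  have h := Kernel.map_frestrictLe_trajMeasure_compProd_eq_map_trajMeasure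
    (X := fun _ => S × A) (μ₀ := d₀ ⊗ₘ π.act) (κ := M.step π) (a := t)
  have h1 := congrArg (fun m => ∫⁻ z, f z.2 ∂m) h
  have hf' : Measurable fun z : (Finset.Iic t → S × A) × (S × A) => f z.2 :=
    hf.comp measurable_snd
  have hp : IsProbabilityMeasure ((M.traj d₀ π).map (Preorder.frestrictLe (π := fun _ => S × A) t)) :=
    Measure.isProbabilityMeasure_map (by fun_prop)
  rw [lintegral_map hf' (by fun_prop)] at h1
  change ∫⁻ z, f z.2 ∂((M.traj d₀ π).map (Preorder.frestrictLe (π := fun _ => S × A) t) ⊗ₘ M.step π t)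
    = ∫⁻ ω, f (ω (t + 1)) ∂(M.traj d₀ π) at h1
  rw [← h1, Measure.lintegral_compProd hf', lintegral_map]
  · rfl
  · exact hf'.lintegral_kernel_prod_right'
  · fun_prop

lemma Model.lintegral_chain (M : Model S A ν) (π : Policy S A) {f : S × A → ℝ≥0∞}
    (hf : Measurable f) (x : S × A) :
    ∫⁻ y, f y ∂(M.chain π x) = ∫⁻ s, ∫⁻ a, f (s, a) ∂(π.act s) ∂(M.P x) := by
  rw [Model.chain, Kernel.lintegral_compProd _ _ _ hf]
  rfl

lemma Model.lintegral_P (M : Model S A ν) (x : S × A) {f : S → ℝ≥0∞} (hf : Measurable f) :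
    ∫⁻ s, f s ∂(M.P x) = ∫⁻ s, M.p x s * f s ∂ν := by
  have h : Measurable (Function.uncurry fun x s' => (M.p x s' : ℝ≥0∞)) :=
    M.measurable_p.coe_nnreal_ennreal
  rw [Model.P, Kernel.lintegral_withDensity _ h x hf]
  rfl

/-- The expected reward at time `t` of the chain started in a given state-action pair. -/
noncomputable def Model.rewardAt (M : Model S A ν) (π : Policy S A) : ℕ → S × A → ℝ≥0∞
  | 0, x => ENNReal.ofReal (M.R x)
  | t + 1, x => ∫⁻ y, M.rewardAt π t y ∂(M.chain π x)

lemma Model.measurable_rewardAt (M : Model S A ν) (π : Policy S A) (t : ℕ) :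
    Measurable (M.rewardAt π t) := by
  induction t with
  | zero => exact M.measurable_R.ennreal_ofReal
  | succ t ih => exact ih.lintegral_kernel

lemma Model.rewardAt_le_one (M : Model S A ν) (π : Policy S A) (t : ℕ) (x : S × A) :
    M.rewardAt π t x ≤ 1 := by
  induction t generalizing x with
  | zero => exact ENNReal.ofReal_le_one.2 (M.R_mem x).2
  | succ t ih => exact (lintegral_mono ih).trans (by simp)

/-- The Markov property trades one unit of trajectory time for one application of the chain kernel;
the induction on `t` therefore needs all `k` at once. -/
lemma Model.lintegral_rewardAt (M : Model S A ν) (d₀ : Measure S) [IsProbabilityMeasure d₀]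
    (π : Policy S A) (t k : ℕ) :
    ∫⁻ ω, M.rewardAt π k (ω t) ∂(M.traj d₀ π) =
      ∫⁻ ω, M.rewardAt π (k + t) (ω 0) ∂(M.traj d₀ π) := by
  induction t generalizing k with
  | zero => rfl
  | succ t ih =>
    rw [M.lintegral_traj_succ d₀ π (M.measurable_rewardAt π k)]
    exact (ih (k + 1)).trans (by rw [Nat.add_right_comm, Nat.add_assoc])

/-- The action value function, with values in `ℝ≥0∞`. -/
noncomputable def Model.actionValue (M : Model S A ν) (γ : ℝ) (π : Policy S A) (x : S × A) :
    ℝ≥0∞ :=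
  ∑' t, ENNReal.ofReal γ ^ t * M.rewardAt π t x

lemma Model.measurable_actionValue (M : Model S A ν) (γ : ℝ) (π : Policy S A) :
    Measurable (M.actionValue γ π) :=
  Measurable.tsum fun t => (M.measurable_rewardAt π t).const_mul _

lemma Model.actionValue_le (M : Model S A ν) (γ : ℝ) (π : Policy S A) (x : S × A) :
    M.actionValue γ π x ≤ (1 - ENNReal.ofReal γ)⁻¹ := by
  rw [← ENNReal.tsum_geometric]
  exact ENNReal.tsum_le_tsum fun t => mul_le_of_le_one_right' (M.rewardAt_le_one π t x)

/-- The Bellman equation, obtained by splitting off the reward at time `0`. -/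
lemma Model.actionValue_eq (M : Model S A ν) (γ : ℝ) (π : Policy S A) (x : S × A) :
    M.actionValue γ π x = ENNReal.ofReal (M.R x) +
      ENNReal.ofReal γ * ∫⁻ y, M.actionValue γ π y ∂(M.chain π x) := by
  unfold Model.actionValue
  rw [tsum_eq_zero_add' ENNReal.summable, lintegral_tsum
    fun t => ((M.measurable_rewardAt π t).const_mul _).aemeasurable, ← ENNReal.tsum_mul_left]
  congr 1
  · simp [Model.rewardAt]
  · refine tsum_congr fun t => ?_
    rw [lintegral_const_mul _ (M.measurable_rewardAt π t), ← mul_assoc, ← pow_succ']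
    rfl

lemma Model.lintegral_return (M : Model S A ν) (γ : ℝ) (d₀ : Measure S) [IsProbabilityMeasure d₀]
    (π : Policy S A) :
    ∑' t : ℕ, ENNReal.ofReal γ ^ t * ∫⁻ ω, ENNReal.ofReal (M.R (ω t)) ∂(M.traj d₀ π) =
      ∫⁻ ω, M.actionValue γ π (ω 0) ∂(M.traj d₀ π) := by
  have hm (t : ℕ) : Measurable fun ω : ℕ → S × A => M.rewardAt π t (ω 0) :=
    (M.measurable_rewardAt π t).comp (measurable_pi_apply 0)
  unfold Model.actionValue
  rw [lintegral_tsum fun t => ((hm t).const_mul _).aemeasurable]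
  refine tsum_congr fun t => ?_
  rw [lintegral_const_mul _ (hm t)]
  congr 1
  exact (M.lintegral_rewardAt d₀ π t 0).trans (by rw [Nat.zero_add])

lemma Model.J_eq (M : Model S A ν) {γ : ℝ} (hγ : 0 ≤ γ) (hγ1 : γ < 1) (d₀ : Measure S)
    [IsProbabilityMeasure d₀] (π : Policy S A) :
    M.J γ d₀ π = (∫⁻ ω, M.actionValue γ π (ω 0) ∂(M.traj d₀ π)).toReal := by
  have hm (t : ℕ) : Measurable fun ω : ℕ → S × A => γ ^ t * M.R (ω t) :=
    (M.measurable_R.comp (measurable_pi_apply t)).const_mul _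
  have h0 (ω : ℕ → S × A) (t : ℕ) : 0 ≤ γ ^ t * M.R (ω t) :=
    mul_nonneg (pow_nonneg hγ t) (M.R_mem _).1
  have hs (ω : ℕ → S × A) : Summable fun t => γ ^ t * M.R (ω t) :=
    (summable_geometric_of_lt_one hγ hγ1).of_nonneg_of_le (h0 ω)
      fun t => mul_le_of_le_one_right (pow_nonneg hγ t) (M.R_mem _).2
  rw [Model.J, integral_eq_lintegral_of_nonneg_ae (ae_of_all _ fun ω => tsum_nonneg (h0 ω))
    (Measurable.tsum hm).aestronglyMeasurable, ← M.lintegral_return]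
  congr 1
  simp_rw [fun ω => ENNReal.ofReal_tsum_of_nonneg (h0 ω) (hs ω)]
  rw [lintegral_tsum fun t => (hm t).ennreal_ofReal.aemeasurable]
  refine tsum_congr fun t => ?_
  have hr : Measurable fun ω : ℕ → S × A => ENNReal.ofReal (M.R (ω t)) :=
    (M.measurable_R.comp (measurable_pi_apply t)).ennreal_ofReal
  rw [← lintegral_const_mul _ hr]
  refine lintegral_congr fun ω => ?_
  rw [ENNReal.ofReal_mul (pow_nonneg hγ t), ENNReal.ofReal_pow hγ]

lemma Model.lintegral_actionValue_ne_top (M : Model S A ν) {γ : ℝ} (hγ1 : γ < 1) (π : Policy S A)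
    {X : Type*} [MeasurableSpace X] (m : Measure X) [IsProbabilityMeasure m] (f : X → S × A) :
    ∫⁻ z, M.actionValue γ π (f z) ∂m ≠ ⊤ := by
  refine ((lintegral_mono fun z => M.actionValue_le γ π (f z)).trans_lt ?_).ne
  rw [lintegral_const, measure_univ, mul_one, ENNReal.inv_lt_top, tsub_pos_iff_lt]
  simpa using hγ1

/-- The state value function agrees with the average of the action value function. -/
lemma Model.lintegral_act_actionValue (M : Model S A ν) {γ : ℝ} (hγ : 0 ≤ γ) (hγ1 : γ < 1)
    (π : Policy S A) (s : S) :
    ∫⁻ a, M.actionValue γ π (s, a) ∂(π.act s) = ENNReal.ofReal (M.V γ π s) := by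
  have hm : Measurable fun s => ∫⁻ a, M.actionValue γ π (s, a) ∂(π.act s) :=
    (M.measurable_actionValue γ π).lintegral_kernel_prod_right'
  rw [Model.V, M.J_eq hγ hγ1, ENNReal.ofReal_toReal (M.lintegral_actionValue_ne_top hγ1 π _ _),
    M.lintegral_traj_zero _ π (M.measurable_actionValue γ π), lintegral_dirac' _ hm]

end Chain

/-! ### The simulation lemma. -/

section Simulation

/-- Unrolling the recursion `N` times leaves the remainder `c ^ N * a N`, which vanishes because `a`
is bounded. In the reverse inequality below, the remainder is simply dropped. -/
lemma le_tsum_add_of_recursion {a r g : ℕ → ℝ≥0∞} {c B : ℝ≥0∞} (hc : c < 1) (hB : B ≠ ⊤)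
    (ha : ∀ t, a t ≤ B) (h : ∀ t, a t ≤ r t + g t + c * a (t + 1)) :
    a 0 ≤ ∑' t, c ^ t * r t + ∑' t, c ^ t * g t := by
  have h1 (N : ℕ) : a 0 ≤ ∑ t ∈ Finset.range N, c ^ t * (r t + g t) + c ^ N * a N := by
    induction N with
    | zero => simp
    | succ N ih =>
      refine ih.trans ?_
      rw [Finset.sum_range_succ, add_assoc]
      gcongr
      calc c ^ N * a N ≤ c ^ N * (r N + g N + c * a (N + 1)) := by gcongr; exact h N
        _ = _ := by rw [mul_add, ← mul_assoc, pow_succ]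
  have h2 (N : ℕ) : a 0 ≤ ∑' t, c ^ t * (r t + g t) + c ^ N * B :=
    (h1 N).trans (add_le_add (ENNReal.sum_le_tsum _) (by gcongr; exact ha N))
  have h3 : Filter.Tendsto (fun N => ∑' t, c ^ t * (r t + g t) + c ^ N * B) Filter.atTop
      (nhds (∑' t, c ^ t * (r t + g t) + 0 * B)) :=
    tendsto_const_nhds.add (ENNReal.Tendsto.mul_const
      (ENNReal.tendsto_pow_atTop_nhds_zero_of_lt_one hc) (Or.inr hB))
  have h4 := ge_of_tendsto' h3 h2
  simpa [mul_add, ENNReal.tsum_add] using h4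

lemma tsum_le_add_of_recursion {a r g : ℕ → ℝ≥0∞} {c : ℝ≥0∞}
    (h : ∀ t, r t + c * a (t + 1) ≤ a t + g t) :
    ∑' t, c ^ t * r t ≤ a 0 + ∑' t, c ^ t * g t := by
  have h1 (N : ℕ) : ∑ t ∈ Finset.range N, c ^ t * r t + c ^ N * a N ≤
      a 0 + ∑ t ∈ Finset.range N, c ^ t * g t := by
    induction N with
    | zero => simp
    | succ N ih =>
      calc ∑ t ∈ Finset.range (N + 1), c ^ t * r t + c ^ (N + 1) * a (N + 1)
          = ∑ t ∈ Finset.range N, c ^ t * r t + c ^ N * (r N + c * a (N + 1)) := by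
            rw [Finset.sum_range_succ]; ring
        _ ≤ ∑ t ∈ Finset.range N, c ^ t * r t + c ^ N * (a N + g N) :=
            add_le_add_right (mul_le_mul_right (h N) _) _
        _ = (∑ t ∈ Finset.range N, c ^ t * r t + c ^ N * a N) + c ^ N * g N := by ring
        _ ≤ (a 0 + ∑ t ∈ Finset.range N, c ^ t * g t) + c ^ N * g N := by gcongr
        _ = _ := by rw [Finset.sum_range_succ, add_assoc]
  exact ENNReal.tsum_le_of_sum_range_le fun N =>
    (le_self_add.trans (h1 N)).trans (by gcongr; exact ENNReal.sum_le_tsum _)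

variable {S A : Type*} [MeasurableSpace S] [MeasurableSpace A] {ν : Measure S}

lemma Model.measurable_p_apply (M : Model S A ν) (x : S × A) : Measurable (M.p x) :=
  M.measurable_p.of_uncurry_left

lemma Model.integrable_p (M : Model S A ν) (x : S × A) : Integrable (fun s => (M.p x s : ℝ)) ν := by
  refine ⟨(M.measurable_p_apply x).coe_nnreal_real.aestronglyMeasurable, ?_⟩
  simp [HasFiniteIntegral, M.lintegral_p x]

lemma Model.integral_p (M : Model S A ν) (x : S × A) : ∫ s, (M.p x s : ℝ) ∂ν = 1 := by
  rw [integral_eq_lintegral_of_nonneg_ae (f := fun s => (M.p x s : ℝ))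
    (ae_of_all _ fun s => (M.p x s).2) (M.measurable_p_apply x).coe_nnreal_real.aestronglyMeasurable]
  simp [M.lintegral_p x]

lemma Model.integrable_abs_sub (M M' : Model S A ν) (x : S × A) :
    Integrable (fun s => |(M.p x s : ℝ) - M'.p x s|) ν :=
  ((M.integrable_p x).sub (M'.integrable_p x)).abs

lemma Model.tv_nonneg (M M' : Model S A ν) (x : S × A) : 0 ≤ M.tv M' x := by
  unfold Model.tv
  positivity

lemma Model.tv_le_one (M M' : Model S A ν) (x : S × A) : M.tv M' x ≤ 1 := by
  have h : ∫ s, |(M.p x s : ℝ) - M'.p x s| ∂ν ≤ ∫ s, ((M.p x s : ℝ) + M'.p x s) ∂ν :=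
    integral_mono (M.integrable_abs_sub M' x) ((M.integrable_p x).add (M'.integrable_p x))
      fun s => (abs_sub _ _).trans (by simp)
  rw [integral_add (M.integrable_p x) (M'.integrable_p x), M.integral_p, M'.integral_p] at h
  unfold Model.tv
  linarith

lemma Model.tv_comm (M M' : Model S A ν) (x : S × A) : M.tv M' x = M'.tv M x := by
  simp only [Model.tv, abs_sub_comm]

lemma Model.err_nonneg (Mstar M : Model S A ν) (Vmax : ℝ) (x : S × A) :
    0 ≤ Mstar.err Vmax M x := by
  unfold Model.err
  positivity

lemma Model.abs_R_sub_le_one (M M' : Model S A ν) (x : S × A) : |M.R x - M'.R x| ≤ 1 := by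
  have h1 := M.R_mem x
  have h2 := M'.R_mem x
  rw [abs_le]
  constructor <;> linarith [h1.1, h1.2, h2.1, h2.2]

lemma Model.sq_R_sub_div_le_one (M M' : Model S A ν) {Vmax : ℝ} (hV : 1 ≤ Vmax) (x : S × A) :
    (M.R x - M'.R x) ^ 2 / Vmax ^ 2 ≤ 1 := by
  rw [div_le_one (by positivity)]
  exact ((sq_le_one_iff_abs_le_one _).2 (M.abs_R_sub_le_one M' x)).trans (one_le_pow₀ hV)

lemma Model.err_le_two (Mstar M : Model S A ν) {Vmax : ℝ} (hV : 1 ≤ Vmax) (x : S × A) :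
    Mstar.err Vmax M x ≤ 2 := by
  unfold Model.err
  have h := M.sq_R_sub_div_le_one Mstar hV x
  have h' := pow_le_one₀ (n := 2) (M.tv_nonneg Mstar x) (M.tv_le_one Mstar x)
  linarith

/-- The pointwise error that enters the comparison of the values of a policy on two models. -/
noncomputable def Model.valueErr (M M' : Model S A ν) (Vmax : ℝ) (x : S × A) : ℝ≥0∞ :=
  ENNReal.ofReal |M.R x - M'.R x| + ENNReal.ofReal (2 * M.tv M' x) * ENNReal.ofReal Vmax

lemma Model.valueErr_comm (M M' : Model S A ν) (Vmax : ℝ) (x : S × A) :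
    M.valueErr M' Vmax x = M'.valueErr M Vmax x := by
  rw [Model.valueErr, Model.valueErr, abs_sub_comm, M.tv_comm]

variable [SigmaFinite ν]

lemma Model.measurable_tv (M M' : Model S A ν) : Measurable (M.tv M') := by
  have h : Measurable (Function.uncurry fun (x : S × A) (s : S) =>
      |(M.p x s : ℝ) - (M'.p x s : ℝ)|) :=
    (M.measurable_p.coe_nnreal_real.sub M'.measurable_p.coe_nnreal_real).abs
  exact (h.stronglyMeasurable.integral_prod_right.measurable).const_mul _

lemma Model.measurable_err (Mstar M : Model S A ν) (Vmax : ℝ) : Measurable (Mstar.err Vmax M) :=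
  ((M.measurable_tv Mstar).pow_const 2).add
    (((M.measurable_R.sub Mstar.measurable_R).pow_const 2).div_const _)

/-- Integrate $p\le p'+|p-p'|$ against `f`; the factor 2 undoes the half in the definition of
`Model.tv`. -/
lemma Model.lintegral_P_le (M M' : Model S A ν) (x : S × A) {f : S → ℝ≥0∞} (hf : Measurable f)
    {B : ℝ} (hB : ∀ s, f s ≤ ENNReal.ofReal B) :
    ∫⁻ s, f s ∂(M.P x) ≤ ∫⁻ s, f s ∂(M'.P x) +
      ENNReal.ofReal (2 * M.tv M' x) * ENNReal.ofReal B := by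
  have h2 : 2 * M.tv M' x = ∫ s, |(M.p x s : ℝ) - M'.p x s| ∂ν := by
    unfold Model.tv
    ring
  have hm : Measurable fun s => ENNReal.ofReal |(M.p x s : ℝ) - M'.p x s| :=
    ((M.measurable_p_apply x).coe_nnreal_real.sub
      (M'.measurable_p_apply x).coe_nnreal_real).abs.ennreal_ofReal
  rw [M.lintegral_P x hf, M'.lintegral_P x hf, h2, ofReal_integral_eq_lintegral_ofReal
    (M.integrable_abs_sub M' x) (ae_of_all _ fun s => abs_nonneg _), ← lintegral_mul_const _ hm,
    ← lintegral_add_right _ (hm.mul_const _)]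
  refine lintegral_mono fun s => ?_
  have h3 : (M.p x s : ℝ≥0∞) ≤ M'.p x s + ENNReal.ofReal |(M.p x s : ℝ) - M'.p x s| := by
    rw [← ENNReal.ofReal_coe_nnreal, ← ENNReal.ofReal_coe_nnreal,
      ← ENNReal.ofReal_add (by positivity) (by positivity)]
    exact ENNReal.ofReal_le_ofReal (by linarith [le_abs_self ((M.p x s : ℝ) - M'.p x s)])
  calc (M.p x s : ℝ≥0∞) * f s
      ≤ (M'.p x s + ENNReal.ofReal |(M.p x s : ℝ) - M'.p x s|) * f s := by gcongr
    _ = M'.p x s * f s + ENNReal.ofReal |(M.p x s : ℝ) - M'.p x s| * f s := by rw [add_mul]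
    _ ≤ _ := by gcongr; exact hB s

lemma Model.measurable_valueErr (M M' : Model S A ν) (Vmax : ℝ) :
    Measurable (M.valueErr M' Vmax) :=
  (M.measurable_R.sub M'.measurable_R).abs.ennreal_ofReal.add
    (((M.measurable_tv M').const_mul 2).ennreal_ofReal.mul_const _)

/-- Compares the Bellman operators of two models on the same `q`. The transitions only see the
action average of `q`, so only this average has to be bounded by `Vmax`. -/
lemma Model.reward_add_chain_le (M₁ M₂ : Model S A ν) {γ : ℝ} (hγ1 : γ ≤ 1)
    (π : Policy S A) {Vmax : ℝ} {q : S × A → ℝ≥0∞} (hq : Measurable q)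
    (hV : ∀ s, ∫⁻ a, q (s, a) ∂(π.act s) ≤ ENNReal.ofReal Vmax) (x : S × A) :
    ENNReal.ofReal (M₁.R x) + ENNReal.ofReal γ * ∫⁻ y, q y ∂(M₁.chain π x) ≤
      ENNReal.ofReal (M₂.R x) + ENNReal.ofReal γ * ∫⁻ y, q y ∂(M₂.chain π x) +
        M₁.valueErr M₂ Vmax x := by
  have h1 : ENNReal.ofReal (M₁.R x) ≤ ENNReal.ofReal (M₂.R x) + ENNReal.ofReal |M₁.R x - M₂.R x| := by
    rw [← ENNReal.ofReal_add (M₂.R_mem x).1 (abs_nonneg _)]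
    exact ENNReal.ofReal_le_ofReal (by linarith [le_abs_self (M₁.R x - M₂.R x)])
  have h2 := M₁.lintegral_P_le M₂ x hq.lintegral_kernel_prod_right' hV
  rw [M₁.lintegral_chain π hq, M₂.lintegral_chain π hq]
  calc _ ≤ (ENNReal.ofReal (M₂.R x) + ENNReal.ofReal |M₁.R x - M₂.R x|) +
        ENNReal.ofReal γ * (∫⁻ s, ∫⁻ a, q (s, a) ∂(π.act s) ∂(M₂.P x) +
          ENNReal.ofReal (2 * M₁.tv M₂ x) * ENNReal.ofReal Vmax) := by gcongr
    _ ≤ (ENNReal.ofReal (M₂.R x) + ENNReal.ofReal |M₁.R x - M₂.R x|) +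
        (ENNReal.ofReal γ * ∫⁻ s, ∫⁻ a, q (s, a) ∂(π.act s) ∂(M₂.P x) +
          ENNReal.ofReal (2 * M₁.tv M₂ x) * ENNReal.ofReal Vmax) := by
        rw [mul_add]
        exact add_le_add_right (add_le_add_right
          (mul_le_of_le_one_left' (ENNReal.ofReal_le_one.2 hγ1)) _) _
    _ = _ := by rw [Model.valueErr]; ring

lemma Model.lintegral_occ (M : Model S A ν) {γ : ℝ} (hγ : 0 ≤ γ) (hγ1 : γ < 1) (d₀ : Measure S)
    (π : Policy S A) {f : S × A → ℝ≥0∞} (hf : Measurable f) :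
    ∫⁻ x, f x ∂(M.occ γ d₀ π) = ENNReal.ofReal (1 - γ) *
      ∑' t : ℕ, ENNReal.ofReal γ ^ t * ∫⁻ ω, f (ω t) ∂(M.traj d₀ π) := by
  rw [Model.occ, lintegral_sum_measure, ← ENNReal.tsum_mul_left]
  refine tsum_congr fun t => ?_
  rw [lintegral_smul_measure, lintegral_map hf (measurable_pi_apply t), smul_eq_mul,
    ENNReal.ofReal_mul (by linarith), ENNReal.ofReal_pow hγ, mul_assoc]

lemma Model.isProbabilityMeasure_occ (M : Model S A ν) {γ : ℝ} (hγ : 0 ≤ γ) (hγ1 : γ < 1)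
    (d₀ : Measure S) [IsProbabilityMeasure d₀] (π : Policy S A) :
    IsProbabilityMeasure (M.occ γ d₀ π) := by
  refine ⟨?_⟩
  have h := M.lintegral_occ hγ hγ1 d₀ π (f := fun _ => 1) measurable_const
  simp only [lintegral_const, measure_univ, mul_one, one_mul, ENNReal.tsum_geometric] at h
  rw [h, ENNReal.ofReal_sub _ hγ, ENNReal.ofReal_one]
  refine ENNReal.mul_inv_cancel ?_ (by simp)
  exact (tsub_pos_iff_lt.2 (by simpa using hγ1)).ne'

/-- The simulation lemma: the values of a policy on two models differ by at most the model error
accumulated along the trajectories of the second model. -/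
lemma Model.ofReal_abs_J_sub_le (M M' : Model S A ν) {γ : ℝ} (hγ : 0 ≤ γ) (hγ1 : γ < 1)
    (d₀ : Measure S) [IsProbabilityMeasure d₀] (π : Policy S A) {Vmax : ℝ}
    (hV : ∀ s, M.V γ π s ≤ Vmax) :
    ENNReal.ofReal (1 - γ) * ENNReal.ofReal |M.J γ d₀ π - M'.J γ d₀ π| ≤
      ∫⁻ x, M.valueErr M' Vmax x ∂(M'.occ γ d₀ π) := by
  have hq := M.measurable_actionValue γ π
  have hqV (s : S) : ∫⁻ a, M.actionValue γ π (s, a) ∂(π.act s) ≤ ENNReal.ofReal Vmax := by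
    rw [M.lintegral_act_actionValue hγ hγ1]
    exact ENNReal.ofReal_le_ofReal (hV s)
  have hg := M.measurable_valueErr M' Vmax
  -- The action value belongs to `M`, the trajectory to `M'`. The Bellman equation of `M` makes `a
  -- t` equal to `r t + γ * a (t + 1)` up to the one-step error `g t`, so both recursion lemmas
  -- apply.
  set a : ℕ → ℝ≥0∞ := fun t => ∫⁻ ω, M.actionValue γ π (ω t) ∂(M'.traj d₀ π) with ha
  set r : ℕ → ℝ≥0∞ := fun t => ∫⁻ ω, ENNReal.ofReal (M'.R (ω t)) ∂(M'.traj d₀ π) with hr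
  set g : ℕ → ℝ≥0∞ := fun t => ∫⁻ ω, M.valueErr M' Vmax (ω t) ∂(M'.traj d₀ π) with hg'
  have hmg (t : ℕ) : Measurable fun ω : ℕ → S × A => M.valueErr M' Vmax (ω t) :=
    hg.comp (measurable_pi_apply t)
  have hmr (t : ℕ) : Measurable fun ω : ℕ → S × A => ENNReal.ofReal (M'.R (ω t)) :=
    (M'.measurable_R.comp (measurable_pi_apply t)).ennreal_ofReal
  have hmc (t : ℕ) : Measurable fun ω : ℕ → S × A =>
      ∫⁻ y, M.actionValue γ π y ∂(M'.chain π (ω t)) :=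
    hq.lintegral_kernel.comp (measurable_pi_apply t)
  have hsum (t : ℕ) : r t + ENNReal.ofReal γ * a (t + 1) = ∫⁻ ω, (ENNReal.ofReal (M'.R (ω t)) +
      ENNReal.ofReal γ * ∫⁻ y, M.actionValue γ π y ∂(M'.chain π (ω t))) ∂(M'.traj d₀ π) := by
    rw [lintegral_add_left (hmr t), lintegral_const_mul _ (hmc t), ha]
    simp only [M'.lintegral_traj_succ d₀ π hq]
    rfl
  have hc : ENNReal.ofReal γ < 1 := by simpa using hγ1
  have up : a 0 ≤ ∑' t, ENNReal.ofReal γ ^ t * r t + ∑' t, ENNReal.ofReal γ ^ t * g t := by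
    refine le_tsum_add_of_recursion (B := (1 - ENNReal.ofReal γ)⁻¹) hc ?_ (fun t => ?_)
      fun t => ?_
    · exact ENNReal.inv_ne_top.2 (tsub_pos_iff_lt.2 hc).ne'
    · exact (lintegral_mono fun ω : ℕ → S × A => M.actionValue_le γ π (ω t)).trans (by simp)
    · rw [add_right_comm, hsum, ← lintegral_add_right _ (hmg t)]
      refine lintegral_mono fun ω => ?_
      rw [M.actionValue_eq]
      exact M.reward_add_chain_le M' hγ1.le π hq hqV (ω t)
  have down : ∑' t, ENNReal.ofReal γ ^ t * r t ≤ a 0 + ∑' t, ENNReal.ofReal γ ^ t * g t := by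
    refine tsum_le_add_of_recursion fun t => ?_
    rw [hsum, ← lintegral_add_right _ (hmg t)]
    refine lintegral_mono fun ω => ?_
    rw [M.actionValue_eq, M.valueErr_comm]
    exact M'.reward_add_chain_le M hγ1.le π hq hqV (ω t)
  rw [M'.lintegral_return] at up down
  have hJ : M.J γ d₀ π = (a 0).toReal := by
    rw [M.J_eq hγ hγ1, M.lintegral_traj_zero d₀ π hq, ha]
    simp only [M'.lintegral_traj_zero d₀ π hq]
  have ha0 : a 0 ≠ ⊤ := M.lintegral_actionValue_ne_top hγ1 π _ _
  have hb0 := M'.lintegral_actionValue_ne_top hγ1 π (M'.traj d₀ π) (fun ω => ω 0)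
  rw [M'.lintegral_occ hγ hγ1 d₀ π hg]
  gcongr
  rcases eq_or_ne (∑' t, ENNReal.ofReal γ ^ t * g t) ⊤ with hG | hG
  · exact le_top.trans_eq hG.symm
  rw [ENNReal.ofReal_le_iff_le_toReal hG, hJ, M'.J_eq hγ hγ1, abs_le]
  have up' := ENNReal.toReal_mono (ENNReal.add_ne_top.2 ⟨hb0, hG⟩) up
  have down' := ENNReal.toReal_mono (ENNReal.add_ne_top.2 ⟨ha0, hG⟩) down
  rw [ENNReal.toReal_add hb0 hG] at up'
  rw [ENNReal.toReal_add ha0 hG] at down'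
  constructor <;> linarith

lemma lintegral_le_rpow_half {X : Type*} [MeasurableSpace X] (m : Measure X)
    [IsProbabilityMeasure m] {f : X → ℝ≥0∞} (hf : AEMeasurable f m) :
    ∫⁻ x, f x ∂m ≤ (∫⁻ x, f x ^ (2 : ℝ) ∂m) ^ (1 / 2 : ℝ) := by
  have h := ENNReal.lintegral_mul_le_Lp_mul_Lq m Real.HolderConjugate.two_two hf
    (aemeasurable_const (b := (1 : ℝ≥0∞)))
  simpa using h

lemma Model.lintegral_valueErr_le (M M' : Model S A ν) {Vmax : ℝ} (hV : 1 ≤ Vmax)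
    (m : Measure (S × A)) [IsProbabilityMeasure m] :
    ∫⁻ x, M.valueErr M' Vmax x ∂m ≤
      (ENNReal.ofReal (5 * Vmax ^ 2) * ∫⁻ x, ENNReal.ofReal (M'.err Vmax M x) ∂m) ^ (1 / 2 : ℝ) := by
  refine (lintegral_le_rpow_half m (M.measurable_valueErr M' Vmax).aemeasurable).trans ?_
  rw [← lintegral_const_mul _ (M'.measurable_err M Vmax).ennreal_ofReal]
  gcongr with x
  have h0 := M.tv_nonneg M' x
  rw [Model.valueErr, ← ENNReal.ofReal_mul (by positivity), ← ENNReal.ofReal_add (by positivity)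
    (by positivity), ENNReal.ofReal_rpow_of_nonneg (by positivity) (by norm_num),
    ← ENNReal.ofReal_mul (by positivity)]
  refine ENNReal.ofReal_le_ofReal ?_
  rw [Real.rpow_two, Model.err, mul_add]
  have h1 : 5 * Vmax ^ 2 * ((M.R x - M'.R x) ^ 2 / Vmax ^ 2) = 5 * |M.R x - M'.R x| ^ 2 := by
    rw [sq_abs]
    field_simp
  rw [h1]
  -- Cauchy–Schwarz in the form $(a+2b)^2\le 5(a^2+b^2)$; the difference of the two sides is
  -- $(2a-b)^2$.
  nlinarith [sq_nonneg (2 * |M.R x - M'.R x| - M.tv M' x * Vmax)]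

end Simulation

/-! ### Exponential moments of the excess loss. -/

section LikelihoodRatio

variable {S A : Type*} [MeasurableSpace S] [MeasurableSpace A] {ν : Measure S}

lemma Model.integrable_sqrt_mul (M M' : Model S A ν) (x : S × A) :
    Integrable (fun s => √(M.p x s : ℝ) * √(M'.p x s : ℝ)) ν := by
  refine ((M.integrable_p x).add (M'.integrable_p x)).mono'
    ((M.measurable_p_apply x).coe_nnreal_real.sqrt.mul
      (M'.measurable_p_apply x).coe_nnreal_real.sqrt).aestronglyMeasurable
    (ae_of_all _ fun s => ?_)
  rw [Real.norm_of_nonneg (by positivity)]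
  have h1 := Real.sq_sqrt (M.p x s).2
  have h2 := Real.sq_sqrt (M'.p x s).2
  simp only [NNReal.val_eq_coe, Pi.add_apply] at h1 h2 ⊢
  nlinarith [sq_nonneg (√(M.p x s : ℝ) - √(M'.p x s : ℝ)), sq_nonneg (√(M.p x s : ℝ)),
    sq_nonneg (√(M'.p x s : ℝ))]

/-- The Bhattacharyya coefficient is controlled by the total variation distance. -/
lemma Model.integral_sqrt_mul_le (M M' : Model S A ν) (x : S × A) :
    ∫ s, √(M.p x s : ℝ) * √(M'.p x s : ℝ) ∂ν ≤ 1 - M.tv M' x ^ 2 / 2 := by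
  set t := M.tv M' x with ht
  set B := ∫ s, √(M.p x s : ℝ) * √(M'.p x s : ℝ) ∂ν with hB
  have h0 : 0 ≤ t := M.tv_nonneg M' x
  have i0 := M.integrable_sqrt_mul M' x
  have i1 := M.integrable_p x
  have i2 := M'.integrable_p x
  have hp (s : S) : √(M.p x s : ℝ) ^ 2 = M.p x s := Real.sq_sqrt (M.p x s).2
  have hq (s : S) : √(M'.p x s : ℝ) ^ 2 = M'.p x s := Real.sq_sqrt (M'.p x s).2
  have i3 : Integrable (fun s => (M.p x s : ℝ) + M'.p x s) ν := i1.add i2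
  have hB1 : 0 ≤ 2 - 2 * B := by
    have h : ∫ s, 2 * (√(M.p x s : ℝ) * √(M'.p x s : ℝ)) ∂ν ≤
        ∫ s, ((M.p x s : ℝ) + M'.p x s) ∂ν := by
      refine integral_mono (i0.const_mul 2) i3 fun s => ?_
      simp only
      nlinarith [sq_nonneg (√(M.p x s : ℝ) - √(M'.p x s : ℝ)), hp s, hq s]
    rw [integral_const_mul, integral_add i1 i2, M.integral_p, M'.integral_p] at h
    linarith
  -- Pointwise $txy\le x^2+t^2y^2/4$ with $x=|\sqrt p-\sqrt{p'}|$ and $y=\sqrt p+\sqrt{p'}$. The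
  -- integral of the left side is $2t^2$, and $B\le 1$ then yields the claim.
  have h : ∫ s, t * |(M.p x s : ℝ) - M'.p x s| ∂ν ≤
      ∫ s, ((1 + t ^ 2 / 4) * ((M.p x s : ℝ) + M'.p x s) -
        (2 - t ^ 2 / 2) * (√(M.p x s : ℝ) * √(M'.p x s : ℝ))) ∂ν := by
    refine integral_mono ((M.integrable_abs_sub M' x).const_mul t)
      ((i3.const_mul _).sub (i0.const_mul _)) fun s => ?_
    have e : |(M.p x s : ℝ) - M'.p x s| =
        |√(M.p x s : ℝ) - √(M'.p x s : ℝ)| * (√(M.p x s : ℝ) + √(M'.p x s : ℝ)) := by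
      have e0 : (M.p x s : ℝ) - M'.p x s =
          (√(M.p x s : ℝ) - √(M'.p x s : ℝ)) * (√(M.p x s : ℝ) + √(M'.p x s : ℝ)) := by
        linear_combination hq s - hp s
      rw [e0, abs_mul, abs_of_nonneg (a := √(M.p x s : ℝ) + √(M'.p x s : ℝ)) (by positivity)]
    simp only [e]
    nlinarith [sq_nonneg (|√(M.p x s : ℝ) - √(M'.p x s : ℝ)| -
      t / 2 * (√(M.p x s : ℝ) + √(M'.p x s : ℝ))), hp s, hq s,
      sq_abs (√(M.p x s : ℝ) - √(M'.p x s : ℝ))]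
  rw [integral_const_mul, integral_sub (i3.const_mul _) (i0.const_mul _),
    integral_const_mul, integral_const_mul, integral_add i1 i2, M.integral_p, M'.integral_p,
    ← hB] at h
  have h2 : ∫ s, |(M.p x s : ℝ) - M'.p x s| ∂ν = 2 * t := by
    rw [ht, Model.tv]
    ring
  rw [h2] at h
  nlinarith [mul_nonneg (sq_nonneg t) hB1]

/-- The excess of the squared reward loss of `M` over the one of the true model. -/
noncomputable def Model.rewardExcess (Mstar M : Model S A ν) (Vmax : ℝ)
    (z : (S × A) × (ℝ × S)) : ℝ :=
  (M.R z.1 - z.2.1) ^ 2 / Vmax ^ 2 - (Mstar.R z.1 - z.2.1) ^ 2 / Vmax ^ 2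

/-- The exponential `exp (-(ℓ_M - ℓ_Mstar) / 4)` of the excess loss of `M` on one tuple. -/
noncomputable def Model.weight (Mstar M : Model S A ν) (Vmax : ℝ) (z : (S × A) × (ℝ × S)) : ℝ :=
  √(√(M.p z.1 z.2.2 / Mstar.p z.1 z.2.2)) * Real.exp (-(Mstar.rewardExcess M Vmax z / 4))

lemma Model.weight_nonneg (Mstar M : Model S A ν) (Vmax : ℝ) (z : (S × A) × (ℝ × S)) :
    0 ≤ Mstar.weight M Vmax z := by
  unfold Model.weight
  positivity

lemma Model.measurable_rewardExcess (Mstar M : Model S A ν) (Vmax : ℝ) :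
    Measurable (Mstar.rewardExcess M Vmax) := by
  have h1 := M.measurable_R
  have h2 := Mstar.measurable_R
  unfold Model.rewardExcess
  fun_prop

lemma Model.measurable_p_snd (M : Model S A ν) :
    Measurable fun z : (S × A) × (ℝ × S) => (M.p z.1 z.2.2 : ℝ) :=
  (M.measurable_p.comp (measurable_fst.prodMk measurable_snd.snd)).coe_nnreal_real

lemma Model.measurable_weight (Mstar M : Model S A ν) (Vmax : ℝ) :
    Measurable (Mstar.weight M Vmax) :=
  (M.measurable_p_snd.div Mstar.measurable_p_snd).sqrt.sqrt.mul
    ((Mstar.measurable_rewardExcess M Vmax).div_const 4).neg.exp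

/-- The excess is affine in the observed reward, so Hoeffding's lemma applies. It costs $u/8$ in the
exponent against the gain $u/2$, where $u=(R_M-R^\star)^2/V_{\max}^2$. -/
lemma Model.integral_exp_rewardExcess_le {Mstar : Model S A ν} (M : Model S A ν) {Vmax : ℝ}
    (hV : 1 ≤ Vmax) {m : Measure (ℝ × S)} [IsProbabilityMeasure m] (x : S × A)
    (hr : ∀ᵐ y ∂m, y.1 ∈ Set.Icc (0 : ℝ) 1) (hR : ∫ y, y.1 ∂m = Mstar.R x) :
    ∫⁻ y, ENNReal.ofReal (Real.exp (-(Mstar.rewardExcess M Vmax (x, y) / 2))) ∂m ≤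
      ENNReal.ofReal (1 - (M.R x - Mstar.R x) ^ 2 / Vmax ^ 2 / 4) := by
  set d := M.R x - Mstar.R x with hd
  set u := d ^ 2 / Vmax ^ 2 with hu
  have hV0 : (0 : ℝ) < Vmax := by linarith
  have hm : AEMeasurable (fun y : ℝ × S => y.1) m := measurable_fst.aemeasurable
  have hs := hasSubgaussianMGF_of_mem_Icc hm hr
  have hint := (hs.integrable_exp_mul (d / Vmax ^ 2)).const_mul (Real.exp (-(u / 2)))
  have hmgf := hs.mgf_le (d / Vmax ^ 2)
  rw [hR] at hint hmgf
  have e (y : ℝ × S) : Real.exp (-(Mstar.rewardExcess M Vmax (x, y) / 2)) =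
      Real.exp (-(u / 2)) * Real.exp (d / Vmax ^ 2 * (y.1 - Mstar.R x)) := by
    rw [← Real.exp_add]
    congr 1
    rw [Model.rewardExcess, hu, hd]
    field_simp
    ring
  have hu0 : 0 ≤ u := by positivity
  have hu1 : u ≤ 1 := M.sq_R_sub_div_le_one Mstar hV x
  simp_rw [e]
  rw [← ofReal_integral_eq_lintegral_ofReal hint (ae_of_all _ fun y => by positivity),
    integral_const_mul]
  refine ENNReal.ofReal_le_ofReal ?_
  have ht : (d / Vmax ^ 2) ^ 2 ≤ u := by
    rw [hu, div_pow]
    gcongr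
    exact le_self_pow₀ hV two_ne_zero
  -- By $e^{3u/8}\ge 1+3u/8$ and $(1+3u/8)(1-u/4)\ge 1$ on $[0,1]$.
  have hexp : Real.exp (-(3 * u / 8)) ≤ 1 - u / 4 := by
    rw [Real.exp_neg]
    refine inv_le_of_inv_le₀ (by linarith) ?_
    refine le_trans ?_ (Real.add_one_le_exp _)
    rw [inv_le_iff_one_le_mul₀ (by linarith)]
    nlinarith
  calc Real.exp (-(u / 2)) * ∫ y, Real.exp (d / Vmax ^ 2 * (y.1 - Mstar.R x)) ∂m
      ≤ Real.exp (-(u / 2)) * Real.exp (u / 8) := by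
        gcongr
        refine hmgf.trans (Real.exp_le_exp.2 ?_)
        simp only [sub_zero, nnnorm_one]
        push_cast
        linarith
    _ = Real.exp (-(3 * u / 8)) := by rw [← Real.exp_add]; congr 1; ring
    _ ≤ _ := hexp

variable [SigmaFinite ν]

lemma Model.lintegral_sqrt_ratio_le (Mstar M : Model S A ν) (x : S × A) :
    ∫⁻ s, ENNReal.ofReal √(M.p x s / Mstar.p x s) ∂(Mstar.P x) ≤
      ENNReal.ofReal (1 - M.tv Mstar x ^ 2 / 2) := by
  have hm : Measurable fun s => ENNReal.ofReal √((M.p x s : ℝ) / Mstar.p x s) :=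
    ((M.measurable_p_apply x).coe_nnreal_real.div
      (Mstar.measurable_p_apply x).coe_nnreal_real).sqrt.ennreal_ofReal
  rw [Mstar.lintegral_P x hm]
  refine le_trans ?_ (ENNReal.ofReal_le_ofReal (M.integral_sqrt_mul_le Mstar x))
  rw [ofReal_integral_eq_lintegral_ofReal (M.integrable_sqrt_mul Mstar x)
    (ae_of_all _ fun s => by positivity)]
  refine lintegral_mono fun s => ?_
  rw [← ENNReal.ofReal_coe_nnreal, ← ENNReal.ofReal_mul (by positivity)]
  refine ENNReal.ofReal_le_ofReal ?_
  rw [Real.sqrt_div' _ (by positivity)]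
  have hq : √(Mstar.p x s : ℝ) * √(Mstar.p x s : ℝ) = Mstar.p x s :=
    Real.mul_self_sqrt (NNReal.coe_nonneg _)
  -- Where the true density vanishes, both sides are zero.
  rcases eq_or_lt_of_le (Real.sqrt_nonneg (Mstar.p x s : ℝ)) with h | h
  · rw [← h]
    simp
  · rw [← mul_div_assoc, div_le_iff₀ h, mul_assoc]
    rw [hq, mul_comm]

/-- Reward and next state may be dependent given `x`. The inequality $ab\le(a^2+b^2)/2$ separates
them; it turns the exponent 1/4 of the weight into the 1/2 of the two preceding bounds. -/
lemma Model.lintegral_weight_le {Mstar : Model S A ν} (M : Model S A ν) {Vmax : ℝ}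
    (hV : 1 ≤ Vmax) {Q : Kernel (S × A) (ℝ × S)} [IsMarkovKernel Q]
    (hQ : Model.Follows Q Mstar) (x : S × A) :
    ∫⁻ y, ENNReal.ofReal (Mstar.weight M Vmax (x, y)) ∂(Q x) ≤
      ENNReal.ofReal (1 - Mstar.err Vmax M x / 8) := by
  have ha : Measurable fun y : ℝ × S => √((M.p x y.2 : ℝ) / Mstar.p x y.2) :=
    (((M.measurable_p_apply x).comp measurable_snd).coe_nnreal_real.div
      ((Mstar.measurable_p_apply x).comp measurable_snd).coe_nnreal_real).sqrt
  have hs : Measurable fun s => ENNReal.ofReal √((M.p x s : ℝ) / Mstar.p x s) :=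
    ((M.measurable_p_apply x).coe_nnreal_real.div
      (Mstar.measurable_p_apply x).coe_nnreal_real).sqrt.ennreal_ofReal
  have h1 : ∫⁻ y, ENNReal.ofReal √((M.p x y.2 : ℝ) / Mstar.p x y.2) ∂(Q x) ≤
      ENNReal.ofReal (1 - M.tv Mstar x ^ 2 / 2) := by
    rw [← lintegral_map hs measurable_snd, hQ.next_state]
    exact Mstar.lintegral_sqrt_ratio_le M x
  have h2 := Model.integral_exp_rewardExcess_le M hV x (hQ.reward_mem x) (hQ.reward_mean x)
  have h3 (y : ℝ × S) : ENNReal.ofReal (Mstar.weight M Vmax (x, y)) ≤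
      ENNReal.ofReal (1 / 2) * (ENNReal.ofReal √((M.p x y.2 : ℝ) / Mstar.p x y.2) +
        ENNReal.ofReal (Real.exp (-(Mstar.rewardExcess M Vmax (x, y) / 2)))) := by
    rw [← ENNReal.ofReal_add (by positivity) (by positivity), ← ENNReal.ofReal_mul (by norm_num)]
    refine ENNReal.ofReal_le_ofReal ?_
    have e1 := Real.sq_sqrt (Real.sqrt_nonneg ((M.p x y.2 : ℝ) / Mstar.p x y.2))
    have e2 : Real.exp (-(Mstar.rewardExcess M Vmax (x, y) / 4)) ^ 2 =
        Real.exp (-(Mstar.rewardExcess M Vmax (x, y) / 2)) := by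
      rw [← Real.exp_nat_mul]
      congr 1
      push_cast
      ring
    rw [Model.weight]
    simp only
    nlinarith [sq_nonneg (√(√((M.p x y.2 : ℝ) / Mstar.p x y.2)) -
      Real.exp (-(Mstar.rewardExcess M Vmax (x, y) / 4)))]
  refine (lintegral_mono h3).trans ?_
  have hu1 := M.sq_R_sub_div_le_one Mstar hV x
  have ht1 := pow_le_one₀ (n := 2) (M.tv_nonneg Mstar x) (M.tv_le_one Mstar x)
  rw [lintegral_const_mul' _ _ ENNReal.ofReal_ne_top, lintegral_add_left ha.ennreal_ofReal]
  refine (mul_le_mul_right (add_le_add h1 h2) _).trans ?_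
  rw [← ENNReal.ofReal_add (by linarith) (by linarith), ← ENNReal.ofReal_mul (by norm_num)]
  refine ENNReal.ofReal_le_ofReal ?_
  rw [Model.err]
  nlinarith [sq_nonneg (M.tv Mstar x)]

lemma Model.integrable_err (Mstar M : Model S A ν) {Vmax : ℝ} (hV : 1 ≤ Vmax)
    (μ : Measure (S × A)) [IsProbabilityMeasure μ] : Integrable (Mstar.err Vmax M) μ :=
  Integrable.of_mem_Icc 0 2 (Mstar.measurable_err M Vmax).aemeasurable
    (ae_of_all _ fun x => ⟨Mstar.err_nonneg M Vmax x, Mstar.err_le_two M hV x⟩)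

lemma Model.lintegral_compProd_weight_le {Mstar : Model S A ν} (M : Model S A ν) {Vmax : ℝ}
    (hV : 1 ≤ Vmax) {Q : Kernel (S × A) (ℝ × S)} [IsMarkovKernel Q]
    (hQ : Model.Follows Q Mstar) (μ : Measure (S × A)) [IsProbabilityMeasure μ] :
    ∫⁻ z, ENNReal.ofReal (Mstar.weight M Vmax z) ∂(μ ⊗ₘ Q) ≤
      ENNReal.ofReal (Real.exp (-((∫ x, Mstar.err Vmax M x ∂μ) / 8))) := by
  have hi := Mstar.integrable_err M hV μ
  have hi' : Integrable (fun x => 1 - Mstar.err Vmax M x / 8) μ :=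
    (integrable_const 1).sub (hi.div_const 8)
  rw [Measure.lintegral_compProd (Mstar.measurable_weight M Vmax).ennreal_ofReal]
  refine (lintegral_mono fun x => Model.lintegral_weight_le M hV hQ x).trans ?_
  rw [← ofReal_integral_eq_lintegral_ofReal hi'
    (ae_of_all _ fun x => ?_), integral_sub (integrable_const 1) (hi.div_const 8),
    integral_div]
  · refine ENNReal.ofReal_le_ofReal ?_
    have := Real.add_one_le_exp (-((∫ x, Mstar.err Vmax M x ∂μ) / 8))
    simp only [integral_const, probReal_univ, smul_eq_mul, mul_one]
    linarith
  · have := Mstar.err_le_two M hV x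
    simp only [Pi.zero_apply]
    linarith

lemma lintegral_pi_prod {n : ℕ} {X : Type*} [MeasurableSpace X] (m : Measure X)
    [IsProbabilityMeasure m] {f : X → ℝ≥0∞} (hf : Measurable f) :
    ∫⁻ D : Fin n → X, ∏ i, f (D i) ∂(Measure.pi fun _ => m) = (∫⁻ z, f z ∂m) ^ n := by
  have hi : iIndepFun (fun (i : Fin n) (D : Fin n → X) => f (D i)) (Measure.pi fun _ => m) :=
    iIndepFun_pi (X := fun _ => f) fun _ => hf.aemeasurable
  rw [lintegral_prod_eq_prod_lintegral_of_indepFun Finset.univ _ hi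
    fun i => hf.comp (measurable_pi_apply i)]
  simp [(measurePreserving_eval (fun _ : Fin n => m) _).lintegral_comp hf]

lemma Model.dataLaw_weight_ge_le {Mstar : Model S A ν} (M : Model S A ν) {Vmax : ℝ}
    (hV : 1 ≤ Vmax) {Q : Kernel (S × A) (ℝ × S)} [IsMarkovKernel Q]
    (hQ : Model.Follows Q Mstar) (μ : Measure (S × A)) [IsProbabilityMeasure μ] (n : ℕ)
    {K : ℝ} (hK : 0 < K) :
    dataLaw μ Q n {D | K * Real.exp (-(n * (∫ x, Mstar.err Vmax M x ∂μ) / 8)) ≤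
      ∏ i, Mstar.weight M Vmax (D i)} ≤ ENNReal.ofReal K⁻¹ := by
  set e := Real.exp (-(n * (∫ x, Mstar.err Vmax M x ∂μ) / 8)) with he
  have he0 : 0 < e := Real.exp_pos _
  have hw := (Mstar.measurable_weight M Vmax).ennreal_ofReal
  have hsub : {D : Dataset S A n | K * e ≤ ∏ i, Mstar.weight M Vmax (D i)} ⊆
      {D | ENNReal.ofReal (K * e) ≤ ∏ i, ENNReal.ofReal (Mstar.weight M Vmax (D i))} := by
    intro D hD
    rw [Set.mem_ofPred_eq, ← ENNReal.ofReal_prod_of_nonneg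
      fun i _ => Mstar.weight_nonneg M Vmax (D i)]
    exact ENNReal.ofReal_le_ofReal hD
  have hmeas : Measurable fun D : Dataset S A n =>
      ∏ i, ENNReal.ofReal (Mstar.weight M Vmax (D i)) :=
    Finset.measurable_prod _ fun i _ => hw.comp (measurable_pi_apply i)
  refine (measure_mono hsub).trans ((meas_ge_le_lintegral_div hmeas.aemeasurable
    (by simpa using mul_pos hK he0) ENNReal.ofReal_ne_top).trans ?_)
  rw [dataLaw, lintegral_pi_prod _ hw]
  have h := pow_le_pow_left' (Model.lintegral_compProd_weight_le M hV hQ μ) n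
  rw [← ENNReal.ofReal_pow (Real.exp_pos _).le, ← Real.exp_nat_mul,
    show (n : ℝ) * -((∫ x, Mstar.err Vmax M x ∂μ) / 8) =
      -(n * (∫ x, Mstar.err Vmax M x ∂μ) / 8) by ring, ← he] at h
  refine (ENNReal.div_le_div_right h _).trans ?_
  rw [← ENNReal.ofReal_div_of_pos (mul_pos hK he0)]
  refine ENNReal.ofReal_le_ofReal (le_of_eq ?_)
  field_simp

/-- Makes the loss of the true model finite, so that the likelihood ratios are genuine. -/
lemma Model.ae_dataLaw_p_pos {Mstar : Model S A ν} {Q : Kernel (S × A) (ℝ × S)} [IsMarkovKernel Q]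
    (hQ : Model.Follows Q Mstar) (μ : Measure (S × A)) [IsProbabilityMeasure μ] (n : ℕ) :
    ∀ᵐ D ∂(dataLaw μ Q n), ∀ i, 0 < (Mstar.p (D i).1 (D i).2.2 : ℝ) := by
  rw [ae_all_iff]
  intro i
  have hm : MeasurableSet {z : (S × A) × (ℝ × S) | 0 < (Mstar.p z.1 z.2.2 : ℝ)} :=
    measurableSet_lt measurable_const Mstar.measurable_p_snd
  have h : ∀ᵐ z ∂(μ ⊗ₘ Q), 0 < (Mstar.p z.1 z.2.2 : ℝ) := by
    rw [Measure.ae_compProd_iff hm]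
    refine ae_of_all _ fun x => ?_
    have hx : MeasurableSet {s | 0 < (Mstar.p x s : ℝ)} :=
      measurableSet_lt measurable_const (Mstar.measurable_p_apply x).coe_nnreal_real
    have h2 : ∀ᵐ s ∂((Q x).map Prod.snd), 0 < (Mstar.p x s : ℝ) := by
      rw [hQ.next_state, ae_iff]
      change Mstar.P x {s | 0 < (Mstar.p x s : ℝ)}ᶜ = 0
      rw [← lintegral_indicator_one hx.compl, Mstar.lintegral_P x
        (measurable_one.indicator hx.compl)]
      refine (lintegral_congr fun s => ?_).trans lintegral_zero
      by_cases hs : 0 < (Mstar.p x s : ℝ)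
      · rw [Set.indicator_of_notMem (by simpa using hs.ne'), mul_zero]
      · have : Mstar.p x s = 0 := by simpa using hs
        simp [this]
    exact ae_of_ae_map measurable_snd.aemeasurable h2
  exact (Measure.tendsto_eval_ae_ae (μ := fun _ : Fin n => μ ⊗ₘ Q) (i := i)).eventually h

end LikelihoodRatio

/-! ### The version space and concentrability. -/

section VersionSpace

lemma ereal_sum_ne_bot {ι : Type*} (s : Finset ι) {f : ι → EReal} (h : ∀ i, f i ≠ ⊥) :
    ∑ i ∈ s, f i ≠ ⊥ := by
  classical
  induction s using Finset.induction_on with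
  | empty => simp
  | insert a s ha ih =>
    rw [Finset.sum_insert ha]
    exact EReal.add_ne_bot_iff.2 ⟨h a, ih⟩

lemma ereal_coe_sum {ι : Type*} (s : Finset ι) (f : ι → ℝ) :
    ((∑ i ∈ s, f i : ℝ) : EReal) = ∑ i ∈ s, (f i : EReal) := by
  classical
  induction s using Finset.induction_on with
  | empty => simp
  | insert a s ha ih => rw [Finset.sum_insert ha, Finset.sum_insert ha, EReal.coe_add, ih]

variable {S A : Type*} [MeasurableSpace S] [MeasurableSpace A] {ν : Measure S}

/-- The real-valued fitting loss, which agrees with `loss` when all observed transitions have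
positive density. -/
noncomputable def Model.fitLoss (M : Model S A ν) (Vmax : ℝ) {n : ℕ} (D : Dataset S A n) : ℝ :=
  ∑ i, (-Real.log (M.p (D i).1 (D i).2.2) + (M.R (D i).1 - (D i).2.1) ^ 2 / Vmax ^ 2)

lemma loss_eq_fitLoss (M : Model S A ν) (Vmax : ℝ) {n : ℕ} (D : Dataset S A n)
    (h : ∀ i, 0 < (M.p (D i).1 (D i).2.2 : ℝ)) :
    loss Vmax D M = (M.fitLoss Vmax D : EReal) := by
  rw [loss, Model.fitLoss, ereal_coe_sum]
  refine Finset.sum_congr rfl fun i _ => ?_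
  rw [ENNReal.log_of_nnreal (NNReal.coe_pos.1 (h i)).ne', EReal.coe_add, EReal.coe_neg]

/-- In `EReal`, `⊤ + ⊥ = ⊥`, so the other summands must be kept away from `⊥`; this holds because
densities are finite. -/
lemma loss_eq_top (M : Model S A ν) (Vmax : ℝ) {n : ℕ} (D : Dataset S A n)
    (h : ¬ ∀ i, 0 < (M.p (D i).1 (D i).2.2 : ℝ)) : loss Vmax D M = ⊤ := by
  push Not at h
  obtain ⟨i, hi⟩ := h
  have hi0 : M.p (D i).1 (D i).2.2 = 0 := by exact_mod_cast le_antisymm hi (NNReal.coe_nonneg _)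
  rw [loss, ← Finset.add_sum_erase _ _ (Finset.mem_univ i), hi0]
  simp only [ENNReal.coe_zero, ENNReal.log_zero, EReal.neg_bot, EReal.top_add_coe]
  refine EReal.top_add_of_ne_bot (ereal_sum_ne_bot _ fun j => ?_)
  refine EReal.add_ne_bot_iff.2 ⟨?_, EReal.coe_ne_bot _⟩
  rw [Ne, EReal.neg_eq_bot_iff, ENNReal.log_eq_top_iff]
  exact ENNReal.coe_ne_top

lemma Model.prod_weight (Mstar M : Model S A ν) (Vmax : ℝ) {n : ℕ} (D : Dataset S A n)
    (hs : ∀ i, 0 < (Mstar.p (D i).1 (D i).2.2 : ℝ)) (h : ∀ i, 0 < (M.p (D i).1 (D i).2.2 : ℝ)) :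
    ∏ i, Mstar.weight M Vmax (D i) =
      Real.exp (-((M.fitLoss Vmax D - Mstar.fitLoss Vmax D) / 4)) := by
  rw [Model.fitLoss, Model.fitLoss, ← Finset.sum_sub_distrib, Finset.sum_div,
    ← Finset.sum_neg_distrib, Real.exp_sum]
  refine Finset.prod_congr rfl fun i _ => ?_
  have hr : 0 < (M.p (D i).1 (D i).2.2 : ℝ) / Mstar.p (D i).1 (D i).2.2 := div_pos (h i) (hs i)
  have e : √(√((M.p (D i).1 (D i).2.2 : ℝ) / Mstar.p (D i).1 (D i).2.2)) =
      Real.exp (Real.log ((M.p (D i).1 (D i).2.2 : ℝ) / Mstar.p (D i).1 (D i).2.2) / 4) := by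
    rw [← Real.exp_log (Real.sqrt_pos.2 (Real.sqrt_pos.2 hr)), Real.log_sqrt (Real.sqrt_nonneg _),
      Real.log_sqrt hr.le]
    congr 1
    ring
  rw [Model.weight, e, ← Real.exp_add, Model.rewardExcess, Real.log_div (h i).ne' (hs i).ne']
  congr 1
  ring

/-- If all likelihood ratios are small, the true model lies in the version space, and all models
of the version space have a small error. -/
lemma mem_versionSpace_of_prod_weight_le {Ms : Finset (Model S A ν)} {Mstar : Model S A ν}
    (hMs : Mstar ∈ Ms) (Vmax L : ℝ) (e : Model S A ν → ℝ) (he : ∀ M ∈ Ms, 0 ≤ e M) {n : ℕ}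
    (D : Dataset S A n) (hs : ∀ i, 0 < (Mstar.p (D i).1 (D i).2.2 : ℝ))
    (hw : ∀ M ∈ Ms, ∏ i, Mstar.weight M Vmax (D i) ≤ Real.exp (L - e M)) :
    Mstar ∈ versionSpace Ms Vmax (4 * L) D ∧ ∀ M ∈ versionSpace Ms Vmax (4 * L) D, e M ≤ 2 * L := by
  obtain ⟨M₀, hM₀, hmin⟩ := Finset.exists_min_image Ms (loss Vmax D) ⟨Mstar, hMs⟩
  have hinf : ⨅ M' ∈ Ms, loss Vmax D M' = loss Vmax D M₀ :=
    le_antisymm (iInf₂_le M₀ hM₀) (le_iInf₂ hmin)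
  have hstar := loss_eq_fitLoss Mstar Vmax D hs
  have hle := hmin Mstar hMs
  have h0 : ∀ i, 0 < (M₀.p (D i).1 (D i).2.2 : ℝ) := by
    by_contra h
    rw [loss_eq_top M₀ Vmax D h, hstar, top_le_iff] at hle
    exact EReal.coe_ne_top _ hle
  have key (M : Model S A ν) (hM : M ∈ Ms) (hp : ∀ i, 0 < (M.p (D i).1 (D i).2.2 : ℝ)) :
      -((M.fitLoss Vmax D - Mstar.fitLoss Vmax D) / 4) ≤ L - e M := by
    have h := hw M hM
    rwa [Mstar.prod_weight M Vmax D hs hp, Real.exp_le_exp] at h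
  rw [loss_eq_fitLoss M₀ Vmax D h0] at hinf hle
  rw [hstar, EReal.coe_le_coe_iff] at hle
  have k0 := key M₀ hM₀ h0
  have e0 := he M₀ hM₀
  -- Membership of the true model is `key` for the minimizer `M₀`, with `e M₀ ≥ 0` dropped. For `M`
  -- in the version space, its loss exceeds that of `Mstar` by at most `4 * L`, so `key` gives `e M
  -- ≤ L + L`.
  refine ⟨⟨hMs, ?_⟩, fun M hM => ?_⟩
  · rw [hinf, hstar, ← EReal.coe_sub, EReal.coe_le_coe_iff]
    linarith
  · obtain ⟨hMm, hM⟩ := hM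
    rw [hinf] at hM
    have hp : ∀ i, 0 < (M.p (D i).1 (D i).2.2 : ℝ) := by
      by_contra h
      rw [loss_eq_top M Vmax D h, EReal.top_sub_coe, top_le_iff] at hM
      exact EReal.coe_ne_top _ hM
    rw [loss_eq_fitLoss M Vmax D hp, ← EReal.coe_sub, EReal.coe_le_coe_iff] at hM
    have k := key M hMm hp
    linarith

variable [SigmaFinite ν]

lemma isProbabilityMeasure_dataLaw (μ : Measure (S × A)) [IsProbabilityMeasure μ]
    (Q : Kernel (S × A) (ℝ × S)) [IsMarkovKernel Q] (n : ℕ) :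
    IsProbabilityMeasure (dataLaw μ Q n) := by
  unfold dataLaw
  infer_instance

/-- Up to probability `δ`, the version space contains the true model, and all its models have a
small error on the data distribution. -/
lemma dataLaw_versionSpace_le {Ms : Finset (Model S A ν)} {Mstar : Model S A ν}
    (hMs : Mstar ∈ Ms) {Vmax : ℝ} (hV : 1 ≤ Vmax) {Q : Kernel (S × A) (ℝ × S)} [IsMarkovKernel Q]
    (hQ : Model.Follows Q Mstar) (μ : Measure (S × A)) [IsProbabilityMeasure μ] (n : ℕ) {δ : ℝ}
    (hδ : 0 < δ) :
    dataLaw μ Q n {D | ¬ (Mstar ∈ versionSpace Ms Vmax (4 * Real.log (Ms.card / δ)) D ∧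
      ∀ M ∈ versionSpace Ms Vmax (4 * Real.log (Ms.card / δ)) D,
        n * (∫ x, Mstar.err Vmax M x ∂μ) / 8 ≤ 2 * Real.log (Ms.card / δ))} ≤
      ENNReal.ofReal δ := by
  have hcard : (0 : ℝ) < Ms.card := by exact_mod_cast Finset.card_pos.2 ⟨Mstar, hMs⟩
  -- With this threshold in Markov's inequality, each model fails with probability at most `δ /
  -- Ms.card`.
  have hK : 0 < Ms.card / δ := div_pos hcard hδ
  have hnull := ae_iff.1 (Model.ae_dataLaw_p_pos hQ μ n)
  have hsub : {D | ¬ (Mstar ∈ versionSpace Ms Vmax (4 * Real.log (Ms.card / δ)) D ∧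
      ∀ M ∈ versionSpace Ms Vmax (4 * Real.log (Ms.card / δ)) D,
        n * (∫ x, Mstar.err Vmax M x ∂μ) / 8 ≤ 2 * Real.log (Ms.card / δ))} ⊆
      {D : Dataset S A n | ¬ ∀ i, 0 < (Mstar.p (D i).1 (D i).2.2 : ℝ)} ∪
      ⋃ M ∈ Ms, {D | Ms.card / δ * Real.exp (-(n * (∫ x, Mstar.err Vmax M x ∂μ) / 8)) ≤
        ∏ i, Mstar.weight M Vmax (D i)} := by
    intro D hD
    by_contra hgood
    rw [Set.mem_union, not_or, Set.mem_iUnion₂] at hgood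
    obtain ⟨hs, hw⟩ := hgood
    have hs' : ∀ i, 0 < (Mstar.p (D i).1 (D i).2.2 : ℝ) := not_not.1 hs
    refine hD (mem_versionSpace_of_prod_weight_le hMs Vmax _
      (fun M => n * (∫ x, Mstar.err Vmax M x ∂μ) / 8) (fun M _ => ?_) D hs' fun M hM => ?_)
    · have : 0 ≤ ∫ x, Mstar.err Vmax M x ∂μ := integral_nonneg fun x => Mstar.err_nonneg M Vmax x
      positivity
    · by_contra hlt
      refine hw ⟨M, hM, ?_⟩
      rw [not_le, sub_eq_add_neg, Real.exp_add, Real.exp_log hK] at hlt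
      exact hlt.le
  refine (measure_mono hsub).trans ((measure_union_le _ _).trans ?_)
  rw [hnull, zero_add]
  refine (measure_biUnion_finset_le _ _).trans ((Finset.sum_le_sum fun M _ =>
    Model.dataLaw_weight_ge_le M hV hQ μ n hK).trans ?_)
  rw [Finset.sum_const, nsmul_eq_mul, ← ENNReal.ofReal_natCast,
    ← ENNReal.ofReal_mul hcard.le]
  refine ENNReal.ofReal_le_ofReal (le_of_eq ?_)
  field_simp

/-- A finite coefficient excludes a zero denominator under a positive numerator, so the quotient can
be multiplied out. -/
lemma lintegral_err_le_concentrability (Mstar : Model S A ν) (γ : ℝ) (d₀ : Measure S) (Vmax : ℝ)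
    {Ms : Finset (Model S A ν)} (μ : Measure (S × A)) [IsFiniteMeasure μ]
    (hV : 1 ≤ Vmax) (π : Policy S A) (hC : concentrability Mstar γ d₀ Vmax Ms μ π ≠ ⊤)
    {M : Model S A ν} (hM : M ∈ Ms) :
    ∫⁻ x, ENNReal.ofReal (Mstar.err Vmax M x) ∂(Mstar.occ γ d₀ π) ≤
      concentrability Mstar γ d₀ Vmax Ms μ π * ∫⁻ x, ENNReal.ofReal (Mstar.err Vmax M x) ∂μ := by
  have h : (∫⁻ x, ENNReal.ofReal (Mstar.err Vmax M x) ∂(Mstar.occ γ d₀ π)) /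
      (∫⁻ x, ENNReal.ofReal (Mstar.err Vmax M x) ∂μ) ≤
      concentrability Mstar γ d₀ Vmax Ms μ π :=
    le_iSup₂_of_le (f := fun M (_ : M ∈ Ms) =>
      (∫⁻ x, ENNReal.ofReal (Mstar.err Vmax M x) ∂(Mstar.occ γ d₀ π)) /
      (∫⁻ x, ENNReal.ofReal (Mstar.err Vmax M x) ∂μ)) M hM le_rfl
  have hfin : ∫⁻ x, ENNReal.ofReal (Mstar.err Vmax M x) ∂μ ≠ ⊤ :=
    ((lintegral_mono fun x => ENNReal.ofReal_le_ofReal (Mstar.err_le_two M hV x)).trans_lt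
      (by simpa using ENNReal.mul_lt_top ENNReal.ofNat_lt_top (measure_lt_top μ _))).ne
  exact (ENNReal.div_le_iff_le_mul (Or.inr hC) (Or.inl hfin)).1 h

lemma Model.ofReal_abs_J_sub_le_concentrability {Ms : Finset (Model S A ν)} (Mstar : Model S A ν)
    {M : Model S A ν} (hM : M ∈ Ms) {γ : ℝ} (hγ : 0 ≤ γ) (hγ1 : γ < 1)
    (d₀ : Measure S) [IsProbabilityMeasure d₀] (π : Policy S A) {Vmax : ℝ} (hV1 : 1 ≤ Vmax)
    (hV : ∀ s, M.V γ π s ≤ Vmax) (μ : Measure (S × A)) [IsProbabilityMeasure μ] {ε : ℝ}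
    (hε : 0 < ε) (herr : ∫ x, Mstar.err Vmax M x ∂μ ≤ 16 * ε) :
    ENNReal.ofReal |M.J γ d₀ π - Mstar.J γ d₀ π| ≤
      concentrability Mstar γ d₀ Vmax Ms μ π ^ (1 / 2 : ℝ) *
        ENNReal.ofReal (9 * (Vmax / (1 - γ)) * √ε) := by
  set K := concentrability Mstar γ d₀ Vmax Ms μ π with hK
  have hγ' : 0 < 1 - γ := by linarith
  have hpos : 0 < 9 * (Vmax / (1 - γ)) * √ε := by positivity
  -- For `K = ⊤` the right-hand side is infinite only because `ε > 0`.
  rcases eq_or_ne K ⊤ with hC | hC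
  · rw [hC, ENNReal.top_rpow_of_pos (by norm_num), ENNReal.top_mul (by simpa using hpos)]
    exact le_top
  have := Mstar.isProbabilityMeasure_occ hγ hγ1 d₀ π
  have h1 := (M.ofReal_abs_J_sub_le Mstar hγ hγ1 d₀ π hV).trans
    (M.lintegral_valueErr_le Mstar hV1 (Mstar.occ γ d₀ π))
  have h2 := lintegral_err_le_concentrability Mstar γ d₀ Vmax μ hV1 π hC hM
  rw [← ofReal_integral_eq_lintegral_ofReal (Mstar.integrable_err M hV1 μ)
    (ae_of_all _ (Mstar.err_nonneg M Vmax))] at h2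
  have h3 : ENNReal.ofReal (1 - γ) * ENNReal.ofReal |M.J γ d₀ π - Mstar.J γ d₀ π| ≤
      K ^ (1 / 2 : ℝ) * ENNReal.ofReal (9 * Vmax * √ε) := by
    refine h1.trans ?_
    calc _ ≤ (ENNReal.ofReal (5 * Vmax ^ 2) * (K * ENNReal.ofReal (16 * ε))) ^ (1 / 2 : ℝ) := by
          gcongr
          refine h2.trans ?_
          gcongr
      _ = (K * ENNReal.ofReal (80 * Vmax ^ 2 * ε)) ^ (1 / 2 : ℝ) := by
          rw [mul_left_comm, ← ENNReal.ofReal_mul (by positivity)]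
          congr 3
          ring
      _ = K ^ (1 / 2 : ℝ) * ENNReal.ofReal (√(80 * Vmax ^ 2 * ε)) := by
          rw [ENNReal.mul_rpow_of_nonneg _ _ (by norm_num), ENNReal.ofReal_rpow_of_nonneg
            (by positivity) (by norm_num), ← Real.sqrt_eq_rpow]
      -- The constant: $80=5\cdot 16\le 9^2$.
      _ ≤ _ := by
          gcongr
          refine Real.sqrt_le_iff.2 ⟨by positivity, ?_⟩
          rw [mul_pow, Real.sq_sqrt hε.le, mul_pow]
          nlinarith [mul_nonneg (sq_nonneg Vmax) hε.le]
  calc ENNReal.ofReal |M.J γ d₀ π - Mstar.J γ d₀ π|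
      = ENNReal.ofReal (1 - γ)⁻¹ *
        (ENNReal.ofReal (1 - γ) * ENNReal.ofReal |M.J γ d₀ π - Mstar.J γ d₀ π|) := by
        rw [← mul_assoc, ← ENNReal.ofReal_mul (by positivity), inv_mul_cancel₀ hγ'.ne',
          ENNReal.ofReal_one, one_mul]
    _ ≤ ENNReal.ofReal (1 - γ)⁻¹ * (K ^ (1 / 2 : ℝ) * ENNReal.ofReal (9 * Vmax * √ε)) := by gcongr
    _ = _ := by
        rw [mul_left_comm, ← ENNReal.ofReal_mul (by positivity)]
        congr 2
        ring

lemma worstGap_le {Mα : Set (Model S A ν)} (hfin : Mα.Finite) {M : Model S A ν} (hM : M ∈ Mα)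
    (γ : ℝ) (d₀ : Measure S) (πref π : Policy S A) :
    worstGap Mα γ d₀ πref π ≤ M.J γ d₀ π - M.J γ d₀ πref :=
  csInf_le (hfin.image _).bddBelow ⟨M, hM, rfl⟩

lemma exists_worstGap_eq {Mα : Set (Model S A ν)} (hfin : Mα.Finite) (hne : Mα.Nonempty)
    (γ : ℝ) (d₀ : Measure S) (πref π : Policy S A) :
    ∃ M ∈ Mα, M.J γ d₀ π - M.J γ d₀ πref = worstGap Mα γ d₀ πref π :=
  (hne.image _).csInf_mem (hfin.image _)

end VersionSpace

end OfflineRL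

/-! ### The absolute performance bound. -/

theorem theorem1 :
    ∃ c : ℝ, 0 < c ∧ ∃ C : ℝ, 0 < C ∧
      ∀ (S A : Type*) [MeasurableSpace S] [MeasurableSpace A]
        (ν : Measure S) [SigmaFinite ν]
        (γ : ℝ) (_ : 0 ≤ γ) (_ : γ < 1)
        (d₀ : Measure S) [IsProbabilityMeasure d₀]
        -- finite model class, containing the true model
        (Ms : Finset (Model S A ν)) (Mstar : Model S A ν) (_ : Mstar ∈ Ms)
        -- policy class, reference policy, behavior policy
        (Pol : Set (Policy S A)) (πref πb : Policy S A)
        -- the value functions take values in `[0, Vmax]`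
        (Vmax : ℝ) (_ : 1 ≤ Vmax)
        (_ : ∀ M ∈ Ms, ∀ π ∈ insert πref Pol, ∀ s, M.V γ π s ∈ Set.Icc 0 Vmax)
        -- conditional law of the observed reward and next state
        (Q : Kernel (S × A) (ℝ × S)) [IsMarkovKernel Q] (_ : Model.Follows Q Mstar)
        (n : ℕ) (_ : 0 < n) (δ : ℝ) (_ : 0 < δ) (_ : δ ≤ 1)
        -- comparator policy
        (π : Policy S A) (_ : π ∈ Pol),
        dataLaw (Mstar.occ γ d₀ πb) Q n
          {D | ¬ ∀ πhat : Policy S A,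
            IsArmorPolicy Ms Pol γ d₀ Vmax (c * Real.log (Ms.card / δ)) πref D πhat →
            ENNReal.ofReal (Mstar.J γ d₀ π - Mstar.J γ d₀ πhat) ≤
              (concentrability Mstar γ d₀ Vmax Ms (Mstar.occ γ d₀ πb) π ^ (1 / 2 : ℝ) +
                concentrability Mstar γ d₀ Vmax Ms (Mstar.occ γ d₀ πb) πref ^ (1 / 2 : ℝ)) *
              ENNReal.ofReal
                (C * (Vmax / (1 - γ)) * Real.sqrt (Real.log (Ms.card / δ) / n))} ≤
          ENNReal.ofReal δ := by
  refine ⟨4, by norm_num, 9, by norm_num, ?_⟩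
  intro S A _ _ ν _ γ hγ hγ1 d₀ _ Ms Mstar hMs Pol πref πb Vmax hV1 hV Q _ hQ n hn δ hδ hδ1 π hπ
  have hμ := Mstar.isProbabilityMeasure_occ hγ hγ1 d₀ πb
  set μ := Mstar.occ γ d₀ πb
  have hD := isProbabilityMeasure_dataLaw μ Q n
  -- For `δ = 1` the logarithm may vanish and the right-hand side may be `∞ * 0 = 0`, but the
  -- probability bound is trivial. Otherwise the logarithm is positive.
  rcases hδ1.eq_or_lt with rfl | hδ1
  · exact prob_le_one.trans_eq ENNReal.ofReal_one.symm
  have hcard : (1 : ℝ) ≤ Ms.card := by exact_mod_cast Finset.card_pos.2 ⟨Mstar, hMs⟩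
  have hL : 0 < Real.log (Ms.card / δ) :=
    Real.log_pos ((one_lt_div hδ).2 (hδ1.trans_le hcard))
  have hn' : (0 : ℝ) < n := by exact_mod_cast hn
  refine le_trans (measure_mono ?_) (dataLaw_versionSpace_le hMs hV1 hQ μ n hδ)
  intro D hDbad hgood
  refine hDbad ?_
  obtain ⟨hstar, herr⟩ := hgood
  rintro πhat ⟨-, hmax⟩
  have hfin : (versionSpace Ms Vmax (4 * Real.log (Ms.card / δ)) D).Finite :=
    Ms.finite_toSet.subset fun M hM => hM.1
  -- The worst model is chosen for the comparator `π`, whereas the gap of `πhat` is evaluated at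
  -- `Mstar`.
  obtain ⟨M, hM, hgap⟩ := exists_worstGap_eq hfin ⟨Mstar, hstar⟩ γ d₀ πref π
  have hle := (hmax π hπ).trans (worstGap_le hfin hstar γ d₀ πref πhat)
  have heM : ∫ x, Mstar.err Vmax M x ∂μ ≤ 16 * (Real.log (Ms.card / δ) / n) := by
    have := herr M hM
    rw [mul_div_assoc', le_div_iff₀ hn']
    linarith
  have hε : 0 < Real.log (Ms.card / δ) / n := div_pos hL hn'
  have bound (π' : Policy S A) (hπ' : π' ∈ insert πref Pol) :=
    Mstar.ofReal_abs_J_sub_le_concentrability hM.1 hγ hγ1 d₀ π' hV1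
      (fun s => (hV M hM.1 π' hπ' s).2) μ hε heM
  have hreal : Mstar.J γ d₀ π - Mstar.J γ d₀ πhat ≤
      |M.J γ d₀ π - Mstar.J γ d₀ π| + |M.J γ d₀ πref - Mstar.J γ d₀ πref| := by
    have h1 := neg_abs_le (M.J γ d₀ π - Mstar.J γ d₀ π)
    have h2 := le_abs_self (M.J γ d₀ πref - Mstar.J γ d₀ πref)
    linarith
  refine (ENNReal.ofReal_le_ofReal hreal).trans ?_
  rw [ENNReal.ofReal_add (abs_nonneg _) (abs_nonneg _), add_mul]
  exact add_le_add (bound π (Set.mem_insert_of_mem _ hπ)) (bound πref (Set.mem_insert _ _))
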